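/- Let $V$ be a finite-dimensional real inner product space, $\gamma,\sigma:[\alpha,\beta]\to V$ continuous paths of bounded variation, and $s,t\in[\alpha,\beta]$. For a continuous path $\gamma$ of bounded variation let $S(\gamma)_{\alpha,s}^k=\int_{\alpha<u_1<\dots<u_k<s}d\gamma_{u_1}\otimes\cdots\otimes d\gamma_{u_k}\in V^{\otimes k}$ (with $S(\gamma)^0_{\alpha,s}=1$) be the $k$-th level of its signature, let $\langle\cdot,\cdot\rangle_k$ be the Hilbert–Schmidt inner product on $V^{\otimes k}$, let $$K^{\gamma,\sigma}(s,t)=\sum_{k=0}^\infty\langle S(\gamma)_{\alpha,s}^k,S(\sigma)_{\alpha,t}^k\rangle_k$$ be the signature kernel, and let $L_s(\gamma)$ be the length of $\gamma|_{[\alpha,s]}$. For $x\in\mathbb R$ let $x\gamma$ be the path $u\mapsto x\,\gamma_u$. Let $a<b$ be real numbers, let $w:(a,b)\to(0,\infty)$ be continuous with $w\in L^1(a,b)$, and let $(p_n)_{n\ge 0}$ be real polynomials with $\deg p_n=n$ and $\int_a^b p_mp_nw\,dx=0$ for $m\ne n$. Let $n\ge 0$, let $x_0,\dots,x_n$ be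 the zeros of $p_{n+1}$, and put $$w_k=\int_a^b w(x)\prod_{i\ne k}\Big(\frac{x-x_i}{x_k-x_i}\Big)^2dx,\qquad \pi_{n+1}(x)=\prod_{i=0}^n(x-x_i).$$ Then all these objects are well defined: the series for $K^{x\gamma,\sigma}(s,t)$ is summable for every $x\in\mathbb R$, the function $x\mapsto K^{x\gamma,\sigma}(s,t)\,w(x)$ is integrable on $(a,b)$, and $p_{n+1}$ has exactly $n+1$ distinct real zeros. Moreover there is a $\xi\in(a,b)$ such that $$\left|\int_a^bK^{x\gamma,\sigma}(s,t)\,w(x)\,dx-\sum_{k=0}^nw_kK^{x_k\gamma,\sigma}(s,t)\right|\le\frac{L_s(\gamma)^{2n+2}L_t(\sigma)^{2n+2}\exp\big(|\xi|L_s(\gamma)L_t(\sigma)\big)}{[(2n+2)!]^2}\int_a^bw(x)\,\pi_{n+1}(x)^2\,dx .$$ -/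

import Mathlib

open MeasureTheory

noncomputable section

/-- A continuous path `[α, β] → V` of bounded variation. -/
structure BVPath (α β : ℝ) (V : Type*) [NormedAddCommGroup V] where
  toFun : Set.Icc α β → V
  continuous_toFun : Continuous toFun
  boundedVariation : BoundedVariationOn toFun Set.univ

namespace BVPath

variable {α β : ℝ} {V : Type*} [NormedAddCommGroup V] [InnerProductSpace ℝ V]

/-- The rescaled path `x γ`, that is `u ↦ x • γ u`. -/
def scale (x : ℝ) (γ : BVPath α β V) : BVPath α β V where
  toFun u := x • γ.toFun u
  continuous_toFun := γ.continuous_toFun.const_smul x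
  boundedVariation :=
    (lipschitzWith_smul x).lipschitzOnWith.comp_boundedVariationOn
      (Set.mapsTo_univ γ.toFun Set.univ) γ.boundedVariation

/-- `L_s(γ)`: the length (total variation in the norm of `V`) of the path segment `γ|_[α,s]`. -/
def length (γ : BVPath α β V) (s : Set.Icc α β) : ℝ :=
  (eVariationOn γ.toFun (Set.Iic s)).toReal

variable [FiniteDimensional ℝ V]

/-- The `V`-valued Stieltjes measure `dγ` on `[α, β]`. -/
def stieltjes (γ : BVPath α β V) : VectorMeasure (Set.Icc α β) V :=
  haveI : CompleteSpace V := FiniteDimensional.complete ℝ V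
  haveI : CompactIccSpace (Set.Icc α β) := ⟨fun {_ _} => isClosed_Icc.isCompact⟩
  γ.boundedVariation.vectorMeasure

/-- The coefficient `S(γ)_{α,t}(v₁ ⋯ v_k)` of the signature along linear functionals
`v₁, …, v_k` on `V`, by the recursion `S(γ)_{α,t}(1) = 1` and
`S(γ)_{α,t}(v₁ ⋯ v_{k+1}) = ∫_α^t S(γ)_{α,u}(v₁ ⋯ v_k) d v_{k+1}(γ_u)`.
The pairing `toSpanSingleton ℝ v` is `(c, y) ↦ c * v y`, so the integral is the Stieltjes integral
of `S(γ)_{α,u}(v₁ ⋯ v_k)` against `d v_{k+1}(γ_u) = v_{k+1}(dγ_u)` over `[α, t]`. -/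
def sigCoeff (γ : BVPath α β V) : (k : ℕ) → (Fin k → StrongDual ℝ V) → Set.Icc α β → ℝ
  | 0, _, _ => 1
  | k + 1, v, t =>
      ∫ᵛ u in Set.Iic t, sigCoeff γ k (fun i => v i.castSucc) u
        ∂[ContinuousLinearMap.toSpanSingleton ℝ (v (Fin.last k)); γ.stieltjes]

variable {ι : Type*} [Fintype ι]

/-- `⟨S(γ)_{α,s}^k, S(σ)_{α,t}^k⟩_k`: the Hilbert–Schmidt inner product on `V^{⊗k}` of the levels
`k` of the two signatures, as the sum over all words `I = (i₁, …, i_k)` in the orthonormal basis `e`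
of the products of the coefficients along the dual words `e_I^*`. -/
def sigInner (e : OrthonormalBasis ι ℝ V) (γ σ : BVPath α β V) (s t : Set.Icc α β) (k : ℕ) : ℝ :=
  ∑ I : Fin k → ι, γ.sigCoeff k (fun j => innerSL ℝ (e (I j))) s *
    σ.sigCoeff k (fun j => innerSL ℝ (e (I j))) t

/-- The original signature kernel
`K^{γ,σ}(s,t) = ∑_k ⟨S(γ)_{α,s}^k, S(σ)_{α,t}^k⟩_k`. -/
def sigKernel (e : OrthonormalBasis ι ℝ V) (γ σ : BVPath α β V) (s t : Set.Icc α β) : ℝ :=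
  ∑' k : ℕ, sigInner e γ σ s t k

end BVPath

namespace GaussQuadrature

open Polynomial

/-- `p` is a system of orthogonal polynomials with respect to the weight `w` over `(a, b)`:
`deg p_n = n` and `∫_a^b p_m p_n w dx = 0` for `m ≠ n`. -/
structure IsOrthogonalSystem (a b : ℝ) (w : ℝ → ℝ) (p : ℕ → ℝ[X]) : Prop where
  degree_eq : ∀ n : ℕ, (p n).degree = n
  orthogonal : ∀ m n : ℕ, m ≠ n →
    ∫ x in Set.Ioo a b, (p m).eval x * (p n).eval x * w x = 0

/-- The nodes of the `(n+1)`-point rule: the real zeros of `p_{n+1}`. -/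
def nodes (p : ℕ → ℝ[X]) (n : ℕ) : Finset ℝ :=
  (p (n + 1)).roots.toFinset

/-- The quadrature weight at the node `c`, that is
`∫_a^b w(x) ∏_{c' ≠ c} ((x - c') / (c - c'))² dx`, with `c'` running over the other nodes. -/
def weight (a b : ℝ) (w : ℝ → ℝ) (p : ℕ → ℝ[X]) (n : ℕ) (c : ℝ) : ℝ :=
  ∫ x in Set.Ioo a b, w x * ∏ c' ∈ (nodes p n).erase c, ((x - c') / (c - c')) ^ 2

/-- The monic node polynomial `π_{n+1}(x) = ∏ (x - c)`, the product over all nodes `c`. -/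
def nodePoly (p : ℕ → ℝ[X]) (n : ℕ) (x : ℝ) : ℝ :=
  ∏ c ∈ nodes p n, (x - c)

end GaussQuadrature

end

noncomputable section

namespace BVPath

open Set Filter Topology

/-! Level `k` of the signature is homogeneous of degree `k` in the path, so the kernel of `x γ` and
`σ` is a power series `∑ x ^ k A_k`. Write `Λ = L_s(γ) L_t(σ)`, `M = max |a| |b|` and `m = 2n + 2`.

Factorial decay: Minkowski's inequality bounds the Hilbert-Schmidt norm of level `k + 1` by the
integral of that of level `k` against arc length. Parametrising by arc length gives `L ^ k / k!` by
induction (`sigNorm_le`), and Cauchy-Schwarz gives `|A_k| ≤ Λ ^ k / (k!) ^ 2` (`abs_sigInner_le`).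

Quadrature: divide `x ^ k` by `π_{n+1} ^ 2`. The remainder is integrated exactly
(`quadrature_exact`) and agrees with `x ^ k` at the nodes, so the error on `x ^ k` is the integral
of `π_{n+1} ^ 2` times the quotient. On `|x| ≤ M` the quotient is at most `k.choose m * M ^ (k -
m)`.

Summation: since `(j + m)! ≥ m! 2 ^ j`, the total error is at most `Λ ^ m exp (M Λ / 2) / (m!) ^ 2`
times `∫ w π_{n+1} ^ 2`. The gain of `1 / 2` in the exponent leaves room for a `ξ` in the open
interval with `|ξ| ≥ M / 2`; no mean value theorem is needed. -/

instance compactIccSpace (α β : ℝ) : CompactIccSpace (Set.Icc α β) :=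
  ⟨fun {_ _} => isClosed_Icc.isCompact⟩

/-! ### Arc length and the arc-length measure. -/

section Length

variable {α β : ℝ} {V : Type*} [NormedAddCommGroup V]

/-- The left endpoint of `[α, β]`, given any point of the interval. -/
def start (t : Set.Icc α β) : Set.Icc α β := ⟨α, le_rfl, t.2.1.trans t.2.2⟩

lemma start_le (t u : Set.Icc α β) : start t ≤ u := u.2.1

lemma Iic_eq_Icc_start (t u : Set.Icc α β) : Iic u = Icc (start t) u := by
  ext v; simp [start_le]

lemma length_eq_variationOnFromTo (γ : BVPath α β V) (t u : Set.Icc α β) :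
    γ.length u = variationOnFromTo γ.toFun univ (start t) u := by
  rw [variationOnFromTo.eq_of_le _ _ (start_le t u), univ_inter, ← Iic_eq_Icc_start]; rfl

lemma length_sub (γ : BVPath α β V) {u v : Set.Icc α β} :
    γ.length v - γ.length u = variationOnFromTo γ.toFun univ u v := by
  rw [γ.length_eq_variationOnFromTo u v, γ.length_eq_variationOnFromTo u u,
    variationOnFromTo.sub_right γ.boundedVariation.locallyBoundedVariationOn
      (mem_univ _) (mem_univ _) (mem_univ _)]

lemma length_nonneg (γ : BVPath α β V) (t : Set.Icc α β) : 0 ≤ γ.length t :=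
  ENNReal.toReal_nonneg

lemma length_start (γ : BVPath α β V) (t : Set.Icc α β) : γ.length (start t) = 0 := by
  rw [γ.length_eq_variationOnFromTo t, variationOnFromTo.self]

lemma monotone_length (γ : BVPath α β V) : Monotone γ.length := by
  intro u v huv
  rw [← sub_nonneg, length_sub]
  exact variationOnFromTo.nonneg_of_le _ _ huv

lemma norm_sub_le_length_sub (γ : BVPath α β V) {u v : Set.Icc α β} (huv : u ≤ v) :
    ‖γ.toFun v - γ.toFun u‖ ≤ γ.length v - γ.length u := by
  rw [length_sub, ← dist_eq_norm]
  rw [variationOnFromTo.eq_of_le _ _ huv, dist_edist]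
  refine ENNReal.toReal_mono ?_ (eVariationOn.edist_le _ ?_ ?_)
  · exact ((eVariationOn.mono _ (subset_univ _)).trans_lt γ.boundedVariation.lt_top).ne
  · exact ⟨mem_univ _, huv, le_rfl⟩
  · exact ⟨mem_univ _, le_rfl, huv⟩

/-- The variation over a shrinking interval at a point of continuity tends to zero. Continuity makes
the arc-length measure atomless and lets the length take all intermediate values. -/
lemma continuous_length (γ : BVPath α β V) : Continuous γ.length := by
  rw [continuous_iff_continuousAt]
  intro x
  rw [continuousAt_iff_continuous_left_right]
  have key : ∀ a, γ.length a = γ.length x + variationOnFromTo γ.toFun univ x a := fun a => by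
    rw [← length_sub]; ring
  constructor
  · have h0 := (ENNReal.tendsto_toReal ENNReal.zero_ne_top).comp
      (γ.boundedVariation.tendsto_eVariationOn_Icc_zero_left (x := x)
        γ.continuous_toFun.continuousWithinAt)
    rw [nhdsWithin_univ] at h0
    have h1 : Tendsto (fun y => γ.length x - (eVariationOn γ.toFun (univ ∩ Icc y x)).toReal)
        (𝓝[≤] x) (𝓝 (γ.length x - 0)) :=
      tendsto_const_nhds.sub (h0.mono_left nhdsWithin_le_nhds)
    rw [sub_zero] at h1
    refine h1.congr' ?_
    filter_upwards [self_mem_nhdsWithin] with y hy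
    rw [key y, variationOnFromTo.eq_of_ge _ _ hy]; ring
  · rw [show γ.length = variationOnFromTo γ.toFun univ (start x) from
      funext fun a => γ.length_eq_variationOnFromTo x a]
    exact γ.boundedVariation.continuousWithinAt_variationOnFromTo_Ici
      γ.continuous_toFun.continuousWithinAt

/-- The length of a path as a Stieltjes function of its endpoint. -/
def lengthStieltjes (γ : BVPath α β V) : StieltjesFunction (Set.Icc α β) where
  toFun := γ.length
  mono' := γ.monotone_length
  right_continuous' _ := γ.continuous_length.continuousWithinAt

/-- The arc-length measure of a path. -/
def lengthMeasure (γ : BVPath α β V) : Measure (Set.Icc α β) := γ.lengthStieltjes.measure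

instance (γ : BVPath α β V) : IsFiniteMeasure γ.lengthMeasure := by
  refine StieltjesFunction.isFiniteMeasure_of_forall_abs_le
    (C := (eVariationOn γ.toFun univ).toReal) _ fun x => ?_
  change |γ.length x| ≤ _
  rw [abs_of_nonneg (γ.length_nonneg x)]
  exact ENNReal.toReal_mono γ.boundedVariation (eVariationOn.mono _ (subset_univ _))

lemma lengthMeasure_Ioc (γ : BVPath α β V) (u v : Set.Icc α β) :
    γ.lengthMeasure (Ioc u v) = ENNReal.ofReal (γ.length v - γ.length u) :=
  γ.lengthStieltjes.measure_Ioc u v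

lemma lengthMeasure_singleton (γ : BVPath α β V) (u : Set.Icc α β) :
    γ.lengthMeasure {u} = 0 := by
  have h : Function.leftLim γ.lengthStieltjes u = γ.length u :=
    ContinuousWithinAt.leftLim_eq (f := γ.length) γ.continuous_length.continuousWithinAt
  rw [lengthMeasure, StieltjesFunction.measure_singleton, h]
  simp [lengthStieltjes]

lemma lengthMeasure_Iic (γ : BVPath α β V) (u : Set.Icc α β) :
    γ.lengthMeasure (Iic u) = ENNReal.ofReal (γ.length u) := by
  rw [Iic_eq_Icc_start u u, ← Icc_union_Ioc_eq_Icc le_rfl (start_le u u), Icc_self]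
  refine le_antisymm ((measure_union_le _ _).trans ?_) ?_
  · simp [lengthMeasure_singleton, lengthMeasure_Ioc, length_start]
  · refine le_trans ?_ (measure_mono subset_union_right)
    simp [lengthMeasure_Ioc, length_start]

/-- The arc-length parametrisation carries the arc-length measure of `[α, t]` to the Lebesgue
measure of `[0, L_t(γ)]`. -/
lemma map_length_restrict_lengthMeasure (γ : BVPath α β V) (t : Set.Icc α β) :
    (γ.lengthMeasure.restrict (Iic t)).map γ.length = volume.restrict (Ioc 0 (γ.length t)) := by
  have hm := γ.continuous_length.measurable
  have : IsFiniteMeasure ((γ.lengthMeasure.restrict (Iic t)).map γ.length) :=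
    Measure.isFiniteMeasure_map _ _
  refine Measure.ext_of_Iic _ _ fun y => ?_
  rw [Measure.map_apply hm measurableSet_Iic, Measure.restrict_apply (hm measurableSet_Iic),
    Measure.restrict_apply measurableSet_Iic]
  rcases lt_or_ge y 0 with hy | hy
  · have h1 : γ.length ⁻¹' Iic y ∩ Iic t = ∅ := by
      ext v
      simpa using fun h => absurd (h.trans_lt hy) (γ.length_nonneg v).not_gt
    have h2 : Iic y ∩ Ioc 0 (γ.length t) = ∅ := by
      ext v
      simp only [mem_inter_iff, mem_Iic, mem_Ioc, mem_empty_iff_false, iff_false, not_and]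
      intro a b; linarith
    rw [h1, h2]; simp
  · have h2 : Iic y ∩ Ioc 0 (γ.length t) = Ioc 0 (min y (γ.length t)) := by
      ext v; simp; tauto
    rw [h2, Real.volume_Ioc, sub_zero]
    have hclosed : IsClosed (γ.length ⁻¹' Iic y ∩ Iic t) :=
      (isClosed_Iic.preimage γ.continuous_length).inter isClosed_Iic
    have hne : (γ.length ⁻¹' Iic y ∩ Iic t).Nonempty :=
      ⟨start t, by simpa [length_start] using hy, start_le t t⟩
    -- By monotonicity the set is the initial segment ending at its greatest point `u`, which exists
    -- by compactness.
    obtain ⟨u, ⟨hu1, hu2⟩, hu⟩ := hclosed.isCompact.exists_isGreatest hne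
    have hset : γ.length ⁻¹' Iic y ∩ Iic t = Iic u := by
      ext v
      exact ⟨fun h => hu h, fun h => ⟨(γ.monotone_length h).trans hu1, le_trans (mem_Iic.1 h) hu2⟩⟩
    rw [hset, lengthMeasure_Iic]
    congr 1
    refine le_antisymm (le_min hu1 (γ.monotone_length hu2)) ?_
    -- If the length at `u` fell short of the minimum, the intermediate value theorem would give a
    -- point of the set beyond `u`.
    by_contra! hlt
    have : PreconnectedSpace (Set.Icc α β) := Subtype.preconnectedSpace isPreconnected_Icc
    obtain ⟨v, hv⟩ : min y (γ.length t) ∈ range γ.length :=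
      mem_range_of_exists_le_of_exists_ge γ.continuous_length ⟨u, hlt.le⟩ ⟨t, min_le_right _ _⟩
    have hv' : min v t ≤ u := by
      refine hu ⟨?_, min_le_right v t⟩
      exact (γ.monotone_length (min_le_left v t)).trans (hv.trans_le (min_le_left _ _))
    have h3 : γ.length (min v t) = min y (γ.length t) := by
      rcases le_total v t with h | h
      · rw [min_eq_left h, hv]
      · rw [min_eq_right h]
        exact le_antisymm ((γ.monotone_length h).trans_eq hv) (min_le_right _ _)
    exact absurd (γ.monotone_length hv') (not_le.2 (h3 ▸ hlt))

/-- In the arc-length parameter this is `∫ y ^ k dy` over `[0, L]`, the source of the factorials. -/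
lemma setIntegral_length_pow (γ : BVPath α β V) (t : Set.Icc α β) (k : ℕ) :
    ∫ u in Iic t, γ.length u ^ k ∂γ.lengthMeasure = γ.length t ^ (k + 1) / (k + 1) := by
  have h := integral_map (μ := γ.lengthMeasure.restrict (Iic t))
    γ.continuous_length.measurable.aemeasurable (f := fun y : ℝ => y ^ k)
    (by fun_prop)
  rw [← h, map_length_restrict_lengthMeasure,
    ← intervalIntegral.integral_of_le (γ.length_nonneg t), integral_pow]
  simp

end Length
end BVPath

/-! ### Change of pairing in vector-measure integrals. -/

namespace MeasureTheory.VectorMeasure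

open Set Filter Topology

variable {X E E' F G : Type*} {mX : MeasurableSpace X}
  [NormedAddCommGroup E] [NormedSpace ℝ E] [NormedAddCommGroup E'] [NormedSpace ℝ E']
  [NormedAddCommGroup F] [NormedSpace ℝ F] [NormedAddCommGroup G] [NormedSpace ℝ G]
  [CompleteSpace G]

/-- A continuous linear map can be moved from the integrand into the pairing. -/
lemma integral_clm_comp (μ : VectorMeasure X F) (B : E →L[ℝ] F →L[ℝ] G) (T : E' →L[ℝ] E)
    {f : X → E'} (hf : μ.Integrable f) :
    ∫ᵛ x, T (f x) ∂[B; μ] = ∫ᵛ x, f x ∂[B ∘L T; μ] := by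
  refine MeasureTheory.Integrable.induction
    (fun f : X → E' => ∫ᵛ x, T (f x) ∂[B; μ] = ∫ᵛ x, f x ∂[B ∘L T; μ]) ?_ ?_ ?_ ?_ hf
  · intro c s hs hμs
    have hfin : IsFiniteMeasure (μ.restrict s).variation := by
      rw [variation_restrict hs]
      exact ⟨by simpa using hμs⟩
    have h1 : (fun x => T (s.indicator (fun _ => c) x)) = s.indicator (fun _ => T c) := by
      ext x; by_cases hx : x ∈ s <;> simp [hx]
    rw [h1, integral_indicator hs, integral_indicator hs, integral_const, integral_const]
    rfl
  · intro f g _ hf hg h1 h2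
    simp only [Pi.add_apply]
    have hT : (fun x => T (f x + g x)) = fun x => T (f x) + T (g x) := funext fun x => _root_.map_add T _ _
    rw [hT, integral_fun_add hf hg, integral_fun_add (T.integrable_comp hf) (T.integrable_comp hg),
      h1, h2]
  · refine isClosed_eq ?_ continuous_integral
    have h : Continuous fun f : X →₁[μ.variation] E' =>
        ∫ᵛ x, (T.compLp f : X →₁[μ.variation] E) x ∂[B; μ] :=
      continuous_integral.comp (T.compLpL 1 μ.variation).continuous
    refine h.congr fun f => integral_congr_ae (T.coeFn_compLp f)
  · intro f g hfg _ h
    rw [← integral_congr_ae hfg, ← h]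
    exact integral_congr_ae (hfg.mono fun x hx => by simp only [hx])

end MeasureTheory.VectorMeasure

/-! ### The Stieltjes measure and factorial decay of the signature. -/

namespace BVPath

open Set Filter Topology

variable {α β : ℝ} {V : Type*} [NormedAddCommGroup V] [InnerProductSpace ℝ V]
  [FiniteDimensional ℝ V]

lemma stieltjes_Icc (γ : BVPath α β V) {u v : Set.Icc α β} (h : u ≤ v) :
    γ.stieltjes (Icc u v) = γ.toFun v - γ.toFun u := by
  have : CompleteSpace V := FiniteDimensional.complete ℝ V
  rw [stieltjes, BoundedVariationOn.vectorMeasure_Icc _ h,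
    ContinuousWithinAt.rightLim_eq γ.continuous_toFun.continuousWithinAt,
    ContinuousWithinAt.leftLim_eq γ.continuous_toFun.continuousWithinAt]

lemma stieltjes_unique (γ : BVPath α β V) {m : VectorMeasure (Set.Icc α β) V}
    (h : ∀ t : Set.Icc α β, m (Iic t) = γ.toFun t - γ.toFun (start t)) : γ.stieltjes = m := by
  have key : ∀ t : Set.Icc α β, γ.stieltjes (Iic t) = m (Iic t) := fun t => by
    rw [h, Iic_eq_Icc_start t t, stieltjes_Icc γ (start_le t t)]
  refine VectorMeasure.ext_of_generateFrom (range Iic) (by rintro _ ⟨t, rfl⟩; exact key t) ?_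
    isPiSystem_Iic ?_
  · rw [← borel_eq_generateFrom_Iic]; exact BorelSpace.measurable_eq
  · rcases isEmpty_or_nonempty (Set.Icc α β) with hX | ⟨⟨t⟩⟩
    · simp [Set.univ_eq_empty_iff.2 hX]
    · have : (univ : Set (Set.Icc α β)) = Iic ⟨β, t.2.1.trans t.2.2, le_rfl⟩ := by
        ext v; exact iff_of_true trivial v.2.2
      rw [this]; exact key _

/-- Increments over half-open intervals are dominated by arc length, so they extend to a vector
measure with the same domination. Having no atom at the left endpoint, it is `γ.stieltjes` by
uniqueness. -/
lemma enorm_stieltjes_le (γ : BVPath α β V) (s : Set (Set.Icc α β)) :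
    ‖γ.stieltjes s‖ₑ ≤ γ.lengthMeasure s := by
  have : CompleteSpace V := FiniteDimensional.complete ℝ V
  rcases isEmpty_or_nonempty (Set.Icc α β) with hX | hX
  · simp [Set.eq_empty_of_isEmpty s]
  have hB : (inferInstance : MeasurableSpace (Set.Icc α β)) =
      MeasurableSpace.generateFrom {s | ∃ u v : Set.Icc α β, u ≤ v ∧ s = Ioc u v} := by
    have h := borel_eq_generateFrom_Ioc_le (Set.Icc α β)
    refine (BorelSpace.measurable_eq.trans h).trans ?_
    congr 1; ext s; simp only [mem_ofPred_eq]; grind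
  obtain ⟨m, hm, hm'⟩ := VectorMeasure.exists_extension_of_isSetSemiring_of_le_measure_of_generateFrom
    (m := AddContent.onIoc γ.toFun) (μ := γ.lengthMeasure) IsSetSemiring.Ioc (by
      rintro _ ⟨u, v, huv, rfl⟩
      rw [AddContent.onIoc_apply huv, lengthMeasure_Ioc, ← ofReal_norm]
      exact ENNReal.ofReal_le_ofReal (γ.norm_sub_le_length_sub huv)) hB
  rw [γ.stieltjes_unique (m := m) fun t => ?_]
  · exact hm' s
  have h0 : m {start t} = 0 := by
    rw [← enorm_eq_zero, ← nonpos_iff_eq_zero]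
    exact (hm' _).trans (γ.lengthMeasure_singleton _).le
  rw [Iic_eq_Icc_start t t, ← Icc_union_Ioc_eq_Icc le_rfl (start_le t t),
    VectorMeasure.of_union (by simp) measurableSet_Icc measurableSet_Ioc, Icc_self, h0,
    hm _ ⟨_, _, start_le t t, rfl⟩, AddContent.onIoc_apply (start_le t t), zero_add]

lemma variation_stieltjes_le (γ : BVPath α β V) : γ.stieltjes.variation ≤ γ.lengthMeasure :=
  VectorMeasure.variation_le_of_forall_enorm_le fun s _ => γ.enorm_stieltjes_le s

instance (γ : BVPath α β V) : IsFiniteMeasure γ.stieltjes.variation :=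
  isFiniteMeasure_of_le _ γ.variation_stieltjes_le

lemma stieltjes_scale (x : ℝ) (γ : BVPath α β V) : (γ.scale x).stieltjes = x • γ.stieltjes := by
  refine stieltjes_unique _ fun t => ?_
  rw [_root_.smul_apply, Iic_eq_Icc_start t t, stieltjes_Icc γ (start_le t t), smul_sub]
  rfl

lemma integrable_stieltjes (γ : BVPath α β V) {E : Type*} [NormedAddCommGroup E]
    {f : Set.Icc α β → E} (hf : Continuous f) : γ.stieltjes.Integrable f := by
  have h := hf.continuousOn.integrableOn_compact (μ := γ.stieltjes.variation)
    (isCompact_univ (X := Set.Icc α β))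
  rwa [integrableOn_univ] at h

/-- The primitive of a continuous function against the Stieltjes measure of a continuous path
is continuous. -/
lemma continuous_setIntegral_Iic (γ : BVPath α β V) {E G : Type*} [NormedAddCommGroup E]
    [NormedSpace ℝ E] [NormedAddCommGroup G] [NormedSpace ℝ G] (B : E →L[ℝ] V →L[ℝ] G)
    {f : Set.Icc α β → E} (hf : Continuous f) :
    Continuous fun t => ∫ᵛ u in Iic t, f u ∂[B; γ.stieltjes] := by
  simp_rw [← VectorMeasure.integral_indicator measurableSet_Iic]
  rw [continuous_iff_continuousAt]
  intro t
  refine VectorMeasure.continuousAt_of_dominated (bound := fun u => ‖f u‖) ?_ ?_ ?_ ?_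
  · exact Eventually.of_forall fun s =>
      (γ.integrable_stieltjes hf).aestronglyMeasurable.indicator measurableSet_Iic
  · exact Eventually.of_forall fun s => Eventually.of_forall fun u => norm_indicator_le_norm_self _ _
  · exact (γ.integrable_stieltjes hf).norm
  -- The indicators of `Iic s` converge as `s → t` at every point but `t`, which is a null set.
  · have hne : ∀ᵐ u ∂γ.stieltjes.variation, u ≠ t := by
      rw [ae_iff]
      have h : γ.stieltjes.variation {t} = 0 := by
        rw [← nonpos_iff_eq_zero]
        exact (γ.variation_stieltjes_le _).trans (γ.lengthMeasure_singleton t).le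
      simpa using h
    filter_upwards [hne] with u hu
    refine continuousAt_const.congr (f := fun _ => (Iic t).indicator f u) ?_
    rcases hu.lt_or_gt with h | h
    · filter_upwards [Ioi_mem_nhds h] with s hs
      rw [indicator_of_mem (mem_Iic.2 h.le), indicator_of_mem (mem_Iic.2 (le_of_lt hs))]
    · filter_upwards [Iio_mem_nhds h] with s hs
      rw [indicator_of_notMem (by simpa using h), indicator_of_notMem (by simpa using hs)]

lemma continuous_sigCoeff (γ : BVPath α β V) (k : ℕ) (v : Fin k → StrongDual ℝ V) :
    Continuous (γ.sigCoeff k v) := by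
  induction k with
  | zero => exact continuous_const
  | succ k ih => exact γ.continuous_setIntegral_Iic _ (ih _)

lemma sigCoeff_scale (x : ℝ) (γ : BVPath α β V) (k : ℕ) (v : Fin k → StrongDual ℝ V)
    (t : Set.Icc α β) : (γ.scale x).sigCoeff k v t = x ^ k * γ.sigCoeff k v t := by
  induction k generalizing t with
  | zero => simp [sigCoeff]
  | succ k ih =>
    simp only [sigCoeff, stieltjes_scale, ih, VectorMeasure.restrict_smul,
      VectorMeasure.integral_smul_vectorMeasure]
    simp_rw [← smul_eq_mul (a := x ^ k)]
    rw [VectorMeasure.integral_fun_smul]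
    simp only [smul_eq_mul]; ring

variable {ι : Type*} [Fintype ι]

/-- The bilinear form on `ℝ^J × V` with coefficients `c j i` in the basis `e` of `V`. -/
def coeffPairing (e : OrthonormalBasis ι ℝ V) {J : Type*} [Fintype J] (c : J × ι → ℝ) :
    EuclideanSpace ℝ J →L[ℝ] V →L[ℝ] ℝ :=
  ∑ j : J, (EuclideanSpace.proj j : EuclideanSpace ℝ J →L[ℝ] ℝ).smulRight
    (∑ i : ι, c (j, i) • innerSL ℝ (e i))

omit [FiniteDimensional ℝ V] in
-- Cauchy-Schwarz over `J × ι` and Parseval in `V`: the operator norm is at most the Hilbert-Schmidt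
-- norm.
lemma norm_coeffPairing_le (e : OrthonormalBasis ι ℝ V) {J : Type*} [Fintype J] (c : J × ι → ℝ) :
    ‖coeffPairing e c‖ ≤ √(∑ q, c q ^ 2) := by
  refine ContinuousLinearMap.opNorm_le_bound₂ _ (Real.sqrt_nonneg _) fun x v => ?_
  have h : coeffPairing e c x v = ∑ q : J × ι, c q * (x q.1 * inner ℝ (e q.2) v) := by
    simp only [coeffPairing, _root_.sum_apply, ContinuousLinearMap.smulRight_apply,
      _root_.smul_apply, PiLp.proj_apply, innerSL_apply_apply, smul_eq_mul,
      Fintype.sum_prod_type, Finset.mul_sum]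
    exact Finset.sum_congr rfl fun j _ => Finset.sum_congr rfl fun i _ => by ring
  have hx : ∑ q : J × ι, (x q.1 * inner ℝ (e q.2) v) ^ 2 = ‖x‖ ^ 2 * ‖v‖ ^ 2 := by
    rw [EuclideanSpace.real_norm_sq_eq, ← e.sum_sq_inner_right v, Finset.sum_mul_sum,
      Fintype.sum_prod_type]
    simp only [mul_pow]
  rw [h, Real.norm_eq_abs]
  refine Real.abs_le_sqrt (Finset.sum_mul_sq_le_sq_mul_sq _ _ _) |>.trans_eq ?_
  rw [hx, Real.sqrt_mul (Finset.sum_nonneg fun _ _ => sq_nonneg _), ← mul_pow,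
    Real.sqrt_sq (by positivity), mul_assoc]

/-- Minkowski's inequality for the integral of `f ⊗ dγ` in the Hilbert-Schmidt norm. -/
lemma sum_sq_setIntegral_le (e : OrthonormalBasis ι ℝ V) (γ : BVPath α β V) {J : Type*} [Fintype J]
    {f : J → Set.Icc α β → ℝ} (hf : ∀ j, Continuous (f j)) (t : Set.Icc α β) :
    √(∑ q : J × ι, (∫ᵛ u in Iic t, f q.1 u
        ∂[ContinuousLinearMap.toSpanSingleton ℝ (innerSL ℝ (e q.2)); γ.stieltjes]) ^ 2) ≤
      ∫ u in Iic t, √(∑ j, f j u ^ 2) ∂γ.lengthMeasure := by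
  classical
  -- Duality: the integral of `f ⊗ dγ` is paired with its own coefficients `a`. The result is `∑ a ^
  -- 2`, at most `√(∑ a ^ 2)` times the integral of the norm; one factor is then cancelled.
  set a : J × ι → ℝ := fun q => ∫ᵛ u in Iic t, f q.1 u
    ∂[ContinuousLinearMap.toSpanSingleton ℝ (innerSL ℝ (e q.2)); γ.stieltjes] with ha
  set μ := γ.stieltjes.restrict (Iic t) with hμ
  let F : Set.Icc α β → EuclideanSpace ℝ J := fun u => WithLp.toLp 2 fun j => f j u
  have hF : Continuous F := (PiLp.continuous_toLp 2 _).comp (continuous_pi hf)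
  have hfi : ∀ j, μ.Integrable (f j) := fun j => (γ.integrable_stieltjes (hf j)).restrict
  let T : J → ℝ →L[ℝ] EuclideanSpace ℝ J := fun j =>
    ContinuousLinearMap.toSpanSingleton ℝ (EuclideanSpace.single j 1)
  have hFT : ∀ u, F u = ∑ j, T j (f j u) := by
    intro u; ext i
    simp [F, T, Finset.sum_apply, Pi.single_apply]
  have hBT : ∀ j, coeffPairing e a ∘L T j = ∑ i,
      ContinuousLinearMap.toSpanSingleton ℝ (innerSL ℝ (e i)) ∘L
        (a (j, i) • ContinuousLinearMap.id ℝ ℝ) := by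
    intro j
    ext v
    simp [coeffPairing, T]
  have hint : ∫ᵛ u, F u ∂[coeffPairing e a; μ] = ∑ q, a q ^ 2 := by
    simp_rw [hFT]
    rw [VectorMeasure.integral_finsetSum _ fun j _ => (T j).integrable_comp (hfi j),
      Fintype.sum_prod_type]
    refine Finset.sum_congr rfl fun j _ => ?_
    rw [VectorMeasure.integral_clm_comp _ _ _ (hfi j), hBT,
      VectorMeasure.integral_finsetSum_cbm (hfi j)]
    refine Finset.sum_congr rfl fun i _ => ?_
    rw [← VectorMeasure.integral_clm_comp _ _ _ (hfi j), sq]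
    simp only [_root_.smul_apply, ContinuousLinearMap.id_apply]
    rw [VectorMeasure.integral_fun_smul, smul_eq_mul]
  have hnorm : ∀ u, ‖F u‖ = √(∑ j, f j u ^ 2) := fun u => by
    simp [F, EuclideanSpace.norm_eq]
  have hle : ∑ q, a q ^ 2 ≤ √(∑ q, a q ^ 2) * ∫ u in Iic t, ‖F u‖ ∂γ.lengthMeasure := by
    calc ∑ q, a q ^ 2 ≤ ‖∫ᵛ u, F u ∂[coeffPairing e a; μ]‖ := hint ▸ le_abs_self _
      _ ≤ ‖coeffPairing e a‖ * ∫ u, ‖F u‖ ∂μ.variation :=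
        VectorMeasure.norm_integral_le_integral_norm
      _ ≤ _ := by
        refine mul_le_mul (norm_coeffPairing_le e a) ?_
          (integral_nonneg fun _ => norm_nonneg _) (Real.sqrt_nonneg _)
        rw [hμ, VectorMeasure.variation_restrict measurableSet_Iic]
        refine integral_mono_measure (Measure.restrict_mono le_rfl γ.variation_stieltjes_le)
          (Eventually.of_forall fun _ => norm_nonneg _) ?_
        have h := hF.norm.continuousOn.integrableOn_compact (μ := γ.lengthMeasure)
          (isCompact_univ (X := Set.Icc α β))
        exact h.mono_set (subset_univ _)
  simp_rw [← hnorm]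
  set S := √(∑ q, a q ^ 2) with hS
  have hS2 : ∑ q, a q ^ 2 = S * S :=
    (Real.mul_self_sqrt (Finset.sum_nonneg fun _ _ => sq_nonneg _)).symm
  rcases (Real.sqrt_nonneg (∑ q, a q ^ 2)).eq_or_lt with h0 | h0
  · rw [hS, ← h0]; exact integral_nonneg fun _ => norm_nonneg _
  · rw [hS2] at hle
    exact le_of_mul_le_mul_left hle h0

/-- The Hilbert-Schmidt norm of the `k`-th level of the signature of a path. -/
def sigNorm (e : OrthonormalBasis ι ℝ V) (γ : BVPath α β V) (k : ℕ) (t : Set.Icc α β) : ℝ :=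
  √(∑ I : Fin k → ι, γ.sigCoeff k (fun j => innerSL ℝ (e (I j))) t ^ 2)

lemma sigNorm_succ_le (e : OrthonormalBasis ι ℝ V) (γ : BVPath α β V) (k : ℕ) (t : Set.Icc α β) :
    γ.sigNorm e (k + 1) t ≤ ∫ u in Iic t, γ.sigNorm e k u ∂γ.lengthMeasure := by
  refine le_trans (le_of_eq ?_) (γ.sum_sq_setIntegral_le e
    (f := fun I : Fin k → ι => γ.sigCoeff k fun j => innerSL ℝ (e (I j)))
    (fun I => γ.continuous_sigCoeff k _) t)
  rw [sigNorm]
  congr 1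
  -- A word of length `k + 1` is a word of length `k` with a last letter.
  refine Fintype.sum_equiv ((Fin.snocEquiv fun _ => ι).symm.trans (Equiv.prodComm _ _)) _ _ ?_
  intro I
  rfl

/-- The factorial decay of the signature. -/
lemma sigNorm_le (e : OrthonormalBasis ι ℝ V) (γ : BVPath α β V) (k : ℕ) (t : Set.Icc α β) :
    γ.sigNorm e k t ≤ γ.length t ^ k / k.factorial := by
  induction k generalizing t with
  | zero => simp [sigNorm, sigCoeff]
  | succ k ih =>
    have hc : Continuous (γ.sigNorm e k) :=
      Real.continuous_sqrt.comp (continuous_finsetSum _ fun I _ =>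
        (γ.continuous_sigCoeff k _).pow 2)
    have hi : ∀ {f : Set.Icc α β → ℝ}, Continuous f → IntegrableOn f (Iic t) γ.lengthMeasure :=
      fun hf => (hf.continuousOn.integrableOn_compact (isCompact_univ)).mono_set (subset_univ _)
    calc γ.sigNorm e (k + 1) t ≤ ∫ u in Iic t, γ.sigNorm e k u ∂γ.lengthMeasure :=
          γ.sigNorm_succ_le e k t
      _ ≤ ∫ u in Iic t, γ.length u ^ k / k.factorial ∂γ.lengthMeasure :=
          setIntegral_mono (hi hc) (hi ((γ.continuous_length.pow k).div_const _)) ih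
      _ = _ := by
          rw [integral_div, setIntegral_length_pow, div_div, Nat.factorial_succ]
          push_cast; rfl

lemma abs_sigInner_le (e : OrthonormalBasis ι ℝ V) (γ σ : BVPath α β V) (s t : Set.Icc α β)
    (k : ℕ) :
    |sigInner e γ σ s t k| ≤ (γ.length s * σ.length t) ^ k / (k.factorial : ℝ) ^ 2 := by
  calc |sigInner e γ σ s t k| ≤ γ.sigNorm e k s * σ.sigNorm e k t := by
        rw [sigNorm, sigNorm, ← Real.sqrt_mul (Finset.sum_nonneg fun _ _ => sq_nonneg _)]
        exact Real.abs_le_sqrt (Finset.sum_mul_sq_le_sq_mul_sq _ _ _)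
    _ ≤ (γ.length s ^ k / k.factorial) * (σ.length t ^ k / k.factorial) :=
        mul_le_mul (γ.sigNorm_le e k s) (σ.sigNorm_le e k t) (Real.sqrt_nonneg _)
          (div_nonneg (pow_nonneg (γ.length_nonneg s) _) (Nat.cast_nonneg _))
    _ = _ := by rw [mul_pow, div_mul_div_comm, sq]

/-- This makes the kernel a power series in `x`. -/
lemma sigInner_scale (e : OrthonormalBasis ι ℝ V) (x : ℝ) (γ σ : BVPath α β V)
    (s t : Set.Icc α β) (k : ℕ) :
    sigInner e (γ.scale x) σ s t k = x ^ k * sigInner e γ σ s t k := by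
  simp only [sigInner, sigCoeff_scale, Finset.mul_sum, mul_assoc]

end BVPath

/-! ### Orthogonal polynomials and exactness of the Gauss rule. -/

namespace GaussQuadrature

open Polynomial Set

lemma degree_C_mul_le (c : ℝ) (f : ℝ[X]) : (C c * f).degree ≤ f.degree := by
  rw [← smul_eq_C_mul]
  exact degree_smul_le c f

section Weight

variable {a b : ℝ} {w : ℝ → ℝ}

lemma integrableOn_continuous_mul {f : ℝ → ℝ} (hw : IntegrableOn w (Ioo a b))
    (hf : ContinuousOn f (Icc a b)) : IntegrableOn (fun x => f x * w x) (Ioo a b) :=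
  IntegrableOn.continuousOn_mul_of_subset hf hw isCompact_Icc measurableSet_Ioo Ioo_subset_Icc_self

lemma integrableOn_eval_mul (hw : IntegrableOn w (Ioo a b)) (f : ℝ[X]) :
    IntegrableOn (fun x => f.eval x * w x) (Ioo a b) :=
  integrableOn_continuous_mul hw f.continuous.continuousOn

/-- The integrand vanishes on the interval only at the finitely many roots of `f`. -/
lemma integral_eval_mul_pos (hab : a < b) (hw_pos : ∀ x ∈ Ioo a b, 0 < w x)
    (hw : IntegrableOn w (Ioo a b)) {f : ℝ[X]} (hf0 : f ≠ 0)
    (hf : ∀ x ∈ Ioo a b, 0 ≤ f.eval x) : 0 < ∫ x in Ioo a b, f.eval x * w x := by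
  rw [setIntegral_pos_iff_support_of_nonneg_ae
    ((ae_restrict_iff' measurableSet_Ioo).2 (Filter.Eventually.of_forall fun x hx =>
      mul_nonneg (hf x hx) (hw_pos x hx).le)) (integrableOn_eval_mul hw f)]
  have hsub : Ioo a b \ (f.roots.toFinset : Set ℝ) ⊆
      Function.support (fun x => f.eval x * w x) ∩ Ioo a b := by
    rintro x ⟨hx, hxr⟩
    refine ⟨mul_ne_zero ?_ (hw_pos x hx).ne', hx⟩
    simpa [hf0] using hxr
  refine lt_of_lt_of_le ?_ (measure_mono hsub)
  rw [measure_sdiff_null (f.roots.toFinset.finite_toSet.measure_zero _), Real.volume_Ioo]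
  simpa using hab

variable {p : ℕ → ℝ[X]} (hp : IsOrthogonalSystem a b w p)

include hp

lemma IsOrthogonalSystem.ne_zero (n : ℕ) : p n ≠ 0 := by
  intro h
  simpa [h] using hp.degree_eq n

lemma IsOrthogonalSystem.integral_mul_eq_zero (hw : IntegrableOn w (Ioo a b)) {N m : ℕ}
    (hm : m ≤ N) {q : ℝ[X]} (hq : q.degree < m) :
    ∫ x in Ioo a b, (p N).eval x * q.eval x * w x = 0 := by
  induction m generalizing q with
  | zero =>
    have : q = 0 := by simpa using hq
    simp [this]
  | succ m ih =>
    have hlc : (p m).coeff m ≠ 0 := by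
      have h := leadingCoeff_ne_zero.2 (hp.ne_zero m)
      rwa [leadingCoeff, natDegree_eq_of_degree_eq_some (hp.degree_eq m)] at h
    -- Subtracting this multiple of `p m` removes the degree `m` term of `q`; the multiple itself is
    -- orthogonal to `p N`.
    set c := q.coeff m / (p m).coeff m with hc
    have hr : (q - C c * p m).degree < m := by
      rw [degree_lt_iff_coeff_zero]
      intro k hk
      rcases hk.eq_or_lt with rfl | hk
      · simp [hc, hlc]
      · have h1 : q.coeff k = 0 := coeff_eq_zero_of_degree_lt (hq.trans_le (by exact_mod_cast hk))
        have h2 : (p m).coeff k = 0 := coeff_eq_zero_of_degree_lt (by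
          rw [hp.degree_eq]; exact_mod_cast hk)
        simp [h1, h2]
    have h1 := ih (by omega) hr
    have h2 := hp.orthogonal N m (by omega)
    have heq : ∀ x, (p N).eval x * q.eval x * w x =
        (p N).eval x * (q - C c * p m).eval x * w x + c * ((p N).eval x * (p m).eval x * w x) := by
      intro x; simp only [eval_sub, eval_mul, eval_C]; ring
    simp_rw [heq]
    rw [integral_add, h1, integral_const_mul, h2, mul_zero, add_zero]
    · simpa only [eval_mul, IntegrableOn] using integrableOn_eval_mul hw (p N * (q - C c * p m))
    · simpa only [eval_mul, IntegrableOn] using (integrableOn_eval_mul hw (p N * p m)).const_mul c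

/-- An orthogonal polynomial has no nonconstant divisor of constant sign. -/
lemma IsOrthogonalSystem.not_dvd_of_nonneg (hab : a < b) (hw_pos : ∀ x ∈ Ioo a b, 0 < w x)
    (hw : IntegrableOn w (Ioo a b)) {N : ℕ} {d : ℝ[X]} (hd : 0 < d.degree)
    (hd0 : ∀ x ∈ Ioo a b, 0 ≤ d.eval x) : ¬ d ∣ p N := by
  rintro ⟨q, hq⟩
  have hne := hp.ne_zero N
  rw [hq] at hne
  have hdne := left_ne_zero_of_mul hne
  have hqne := right_ne_zero_of_mul hne
  have hdeg : q.degree < N := by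
    have h := hp.degree_eq N
    rw [hq, degree_mul, degree_eq_natDegree hdne, degree_eq_natDegree hqne] at h
    rw [degree_eq_natDegree hdne] at hd
    rw [degree_eq_natDegree hqne]
    norm_cast at *
    omega
  have h0 := hp.integral_mul_eq_zero hw le_rfl hdeg
  -- If `p N = d * q`, then `p N * q = d * q ^ 2` has positive integral, against orthogonality to
  -- the lower-degree `q`.
  have hpos := integral_eval_mul_pos hab hw_pos hw (f := p N * q)
    (mul_ne_zero (hp.ne_zero N) hqne) fun x hx => by
      rw [hq, eval_mul, eval_mul, mul_assoc]
      exact mul_nonneg (hd0 x hx) (mul_self_nonneg _)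
  simp only [eval_mul] at hpos
  exact hpos.ne' h0

lemma IsOrthogonalSystem.root_mem_Ioo (hab : a < b) (hw_pos : ∀ x ∈ Ioo a b, 0 < w x)
    (hw : IntegrableOn w (Ioo a b)) {N : ℕ} {c : ℝ} (hc : (p N).IsRoot c) : c ∈ Ioo a b := by
  have hdvd := dvd_iff_isRoot.2 hc
  by_contra hmem
  rcases le_or_gt c a with h | h
  · refine hp.not_dvd_of_nonneg hab hw_pos hw (by simp) (fun x hx => ?_) hdvd
    simp only [eval_sub, eval_X, eval_C]
    linarith [hx.1]
  · have hb : b ≤ c := not_lt.1 fun h' => hmem ⟨h, h'⟩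
    refine hp.not_dvd_of_nonneg hab hw_pos hw (d := -(X - C c))
      (by rw [degree_neg, degree_X_sub_C]; exact one_pos)
      (fun x hx => ?_) (neg_dvd.2 hdvd)
    simp only [eval_sub, eval_X, eval_C, eval_neg]
    linarith [hx.2]

/-- A nonlinear irreducible factor has no real root, hence constant sign, namely its sign at `a`. -/
lemma IsOrthogonalSystem.splits (hab : a < b) (hw_pos : ∀ x ∈ Ioo a b, 0 < w x)
    (hw : IntegrableOn w (Ioo a b)) (N : ℕ) : (p N).Splits := by
  rw [splits_iff_splits]
  refine Or.inr fun {g} hg hdvd => ?_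
  by_contra hdeg
  have hroot : ∀ x, g.eval x ≠ 0 := fun x hx =>
    hdeg (degree_eq_one_of_irreducible_of_root hg hx)
  have hpos : 0 < g.degree := hg.degree_pos
  rcases lt_or_gt_of_ne (hroot a) with ha | ha
  · refine hp.not_dvd_of_nonneg hab hw_pos hw (d := -g) (by simpa using hpos)
      (fun x _ => ?_) (neg_dvd.2 hdvd)
    rw [eval_neg, neg_nonneg]
    by_contra! hx
    obtain ⟨y, hy⟩ := mem_range_of_exists_le_of_exists_ge g.continuous ⟨a, ha.le⟩ ⟨x, hx.le⟩
    exact hroot y hy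
  · refine hp.not_dvd_of_nonneg hab hw_pos hw hpos (fun x _ => ?_) hdvd
    by_contra! hx
    obtain ⟨y, hy⟩ := mem_range_of_exists_le_of_exists_ge g.continuous ⟨x, hx.le⟩ ⟨a, ha.le⟩
    exact hroot y hy

lemma IsOrthogonalSystem.nodup_roots (hab : a < b) (hw_pos : ∀ x ∈ Ioo a b, 0 < w x)
    (hw : IntegrableOn w (Ioo a b)) (N : ℕ) : (p N).roots.Nodup := by
  rw [Multiset.nodup_iff_count_le_one]
  intro c
  by_contra! hc
  rw [count_roots] at hc
  have hdvd : (X - C c) ^ 2 ∣ p N := (le_rootMultiplicity_iff (hp.ne_zero N)).1 hc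
  refine hp.not_dvd_of_nonneg hab hw_pos hw ?_ (fun x _ => ?_) hdvd
  · rw [degree_pow, degree_X_sub_C]; norm_num
  · rw [eval_pow]; exact sq_nonneg _

lemma IsOrthogonalSystem.card_nodes (hab : a < b) (hw_pos : ∀ x ∈ Ioo a b, 0 < w x)
    (hw : IntegrableOn w (Ioo a b)) (n : ℕ) : (nodes p n).card = n + 1 := by
  rw [nodes, Multiset.toFinset_card_of_nodup (hp.nodup_roots hab hw_pos hw _),
    splits_iff_card_roots.1 (hp.splits hab hw_pos hw _),
    natDegree_eq_of_degree_eq_some (hp.degree_eq _)]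

omit hp in
/-- The node polynomial as a formal polynomial. -/
def nodePolynomial (p : ℕ → ℝ[X]) (n : ℕ) : ℝ[X] := ∏ c ∈ nodes p n, (X - C c)

omit hp in
lemma eval_nodePolynomial (n : ℕ) (x : ℝ) : (nodePolynomial p n).eval x = nodePoly p n x := by
  simp [nodePolynomial, nodePoly, eval_prod]

lemma IsOrthogonalSystem.eq_C_mul_nodePolynomial (hab : a < b) (hw_pos : ∀ x ∈ Ioo a b, 0 < w x)
    (hw : IntegrableOn w (Ioo a b)) (n : ℕ) :
    p (n + 1) = C (p (n + 1)).leadingCoeff * nodePolynomial p n := by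
  conv_lhs => rw [(hp.splits hab hw_pos hw (n + 1)).eq_prod_roots]
  congr 1
  have h := (hp.nodup_roots hab hw_pos hw (n + 1)).dedup
  rw [nodePolynomial, nodes, Finset.prod, Multiset.toFinset_val, h]

/-- The Gauss quadrature rule with `n + 1` nodes is exact up to degree `2n + 1`. -/
lemma IsOrthogonalSystem.quadrature_exact (hab : a < b) (hw_pos : ∀ x ∈ Ioo a b, 0 < w x)
    (hw : IntegrableOn w (Ioo a b)) {n : ℕ} {r : ℝ[X]} (hr : r.degree < (2 * n + 2 : ℕ)) :
    ∫ x in Ioo a b, r.eval x * w x = ∑ c ∈ nodes p n, weight a b w p n c * r.eval c := by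
  classical
  set S := nodes p n with hS
  have hcard : S.card = n + 1 := hp.card_nodes hab hw_pos hw n
  -- Squared Lagrange basis polynomials, whose integrals against `w` are the quadrature weights.
  let L : ℝ → ℝ[X] := fun c => ∏ c' ∈ S.erase c, (C (c - c')⁻¹ * (X - C c')) ^ 2
  have hLeval : ∀ c x, (L c).eval x = ∏ c' ∈ S.erase c, ((x - c') / (c - c')) ^ 2 := by
    intro c x
    simp only [L, eval_prod, eval_pow, eval_mul, eval_C, eval_sub, eval_X]
    exact Finset.prod_congr rfl fun c' _ => by rw [div_eq_inv_mul]
  have hLself : ∀ c ∈ S, (L c).eval c = 1 := by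
    intro c _
    rw [hLeval]
    refine Finset.prod_eq_one fun c' hc' => ?_
    rw [div_self (sub_ne_zero.2 (Finset.ne_of_mem_erase hc').symm), one_pow]
  have hLne : ∀ c, ∀ c' ∈ S, c' ≠ c → (L c).eval c' = 0 := by
    intro c c' hc' hne
    rw [hLeval]
    exact Finset.prod_eq_zero (Finset.mem_erase.2 ⟨hne, hc'⟩) (by simp)
  have hLdeg : ∀ c ∈ S, (L c).degree < (2 * n + 2 : ℕ) := by
    intro c hc
    have h : (L c).natDegree ≤ ∑ c' ∈ S.erase c, 2 := by
      refine (natDegree_prod_le _ _).trans (Finset.sum_le_sum fun c' _ => ?_)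
      refine natDegree_pow_le.trans ?_
      have h1 : (C (c - c')⁻¹ * (X - C c')).natDegree ≤ 1 :=
        (natDegree_C_mul_le _ _).trans (natDegree_X_sub_C_le _)
      omega
    rw [Finset.sum_const, Finset.card_erase_of_mem hc, hcard, smul_eq_mul] at h
    refine degree_le_natDegree.trans_lt ?_
    norm_cast
    omega
  -- `D` vanishes at all nodes, hence is `p (n + 1)` times a polynomial of degree at most `n` and
  -- integrates to zero.
  set D := r - ∑ c ∈ S, C (r.eval c) * L c with hD
  have hDdeg : D.degree < (2 * n + 2 : ℕ) := by
    refine (degree_sub_le _ _).trans_lt (max_lt hr ?_)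
    refine (degree_sum_le _ _).trans_lt ((Finset.sup_lt_iff (WithBot.bot_lt_coe _)).2 fun c hc => ?_)
    exact (degree_C_mul_le _ _).trans_lt (hLdeg c hc)
  have hDroot : ∀ c ∈ S, D.eval c = 0 := by
    intro c hc
    rw [hD, eval_sub, eval_finsetSum, Finset.sum_eq_single_of_mem c hc, eval_mul, hLself c hc]
    · simp
    · intro c' _ hne
      rw [eval_mul, hLne c' c hc hne.symm, mul_zero]
  have hdvd : p (n + 1) ∣ D := by
    rw [hp.eq_C_mul_nodePolynomial hab hw_pos hw n]
    refine (isUnit_C.2 (isUnit_iff_ne_zero.2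
      (leadingCoeff_ne_zero.2 (hp.ne_zero _)))).mul_left_dvd.2 ?_
    refine Finset.prod_dvd_of_coprime (fun c _ c' _ hne => ?_) fun c hc =>
      dvd_iff_isRoot.2 (hDroot c hc)
    exact pairwise_coprime_X_sub_C Function.injective_id hne
  obtain ⟨q, hq⟩ := hdvd
  have hqdeg : q.degree < (n + 1 : ℕ) := by
    rcases eq_or_ne q 0 with rfl | hq0
    · simp
    rw [hq, degree_mul, hp.degree_eq, degree_eq_natDegree hq0] at hDdeg
    rw [degree_eq_natDegree hq0]
    norm_cast at *
    omega
  have hDint : ∫ x in Ioo a b, D.eval x * w x = 0 := by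
    simp_rw [hq, eval_mul]
    exact hp.integral_mul_eq_zero hw le_rfl hqdeg
  have hsplit : ∀ x, r.eval x * w x =
      D.eval x * w x + ∑ c ∈ S, r.eval c * ((L c).eval x * w x) := by
    intro x
    simp only [hD, eval_sub, eval_finsetSum, eval_mul, eval_C, sub_mul, Finset.sum_mul, mul_assoc]
    ring
  simp_rw [hsplit]
  rw [integral_add (integrableOn_eval_mul hw D)
      (integrable_finsetSum _ fun c _ => (integrableOn_eval_mul hw (L c)).const_mul _),
    hDint, zero_add, integral_finsetSum _ fun c _ => (integrableOn_eval_mul hw (L c)).const_mul _]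
  refine Finset.sum_congr rfl fun c _ => ?_
  rw [integral_const_mul, weight, mul_comm]
  congr 1
  refine integral_congr_ae (Filter.Eventually.of_forall fun x => ?_)
  simp only [hLeval, mul_comm (w x)]
  rfl

end Weight

/-! ### Division of monomials and the quadrature error on them. -/

lemma sum_range_choose_right (m k : ℕ) : ∑ i ∈ Finset.range k, i.choose m = k.choose (m + 1) := by
  induction k with
  | zero => simp
  | succ k ih => rw [Finset.sum_range_succ, ih, Nat.choose_succ_succ, add_comm]

/-- Division of a monomial by a product of linear factors, with a bound for the quotient. -/
lemma exists_monomial_eq_prod_mul_add {M : ℝ} (l : List ℝ) (hl : ∀ c ∈ l, |c| ≤ M) (k : ℕ) :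
    ∃ q r : ℝ[X], X ^ k = (l.map fun c => X - C c).prod * q + r ∧ r.degree < l.length ∧
      ∀ x, |x| ≤ M → |q.eval x| ≤ k.choose l.length * M ^ (k - l.length) := by
  induction l generalizing k with
  | nil =>
    refine ⟨X ^ k, 0, by simp, by simp, fun x hx => ?_⟩
    simpa [abs_pow] using pow_le_pow_left₀ (abs_nonneg x) hx k
  | cons c l ih =>
    have hc : |c| ≤ M := hl c (by simp)
    have hM : 0 ≤ M := (abs_nonneg c).trans hc
    choose q r hqr hr hq using ih fun c hc => hl c (by simp [hc])
    refine ⟨∑ i ∈ Finset.range k, C (c ^ (k - 1 - i)) * q i,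
      (X - C c) * ∑ i ∈ Finset.range k, C (c ^ (k - 1 - i)) * r i + C (c ^ k), ?_, ?_, ?_⟩
    -- `X ^ k - c ^ k = (X - c) ∑ X ^ i c ^ (k - 1 - i)`, and each `X ^ i` is divided by the
    -- remaining factors. The hockey-stick identity then adds up the binomial bounds.
    · have h := (Commute.all X (C c)).geom_sum₂_mul k
      have h2 : ∑ i ∈ Finset.range k, (X : ℝ[X]) ^ i * C c ^ (k - 1 - i) =
          (l.map fun c => X - C c).prod * ∑ i ∈ Finset.range k, C (c ^ (k - 1 - i)) * q i +
            ∑ i ∈ Finset.range k, C (c ^ (k - 1 - i)) * r i := by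
        rw [Finset.mul_sum, ← Finset.sum_add_distrib]
        refine Finset.sum_congr rfl fun i _ => ?_
        rw [hqr i, C_pow]; ring
      rw [h2] at h
      rw [List.map_cons, List.prod_cons, C_pow]
      linear_combination -h
    · have h1 : (∑ i ∈ Finset.range k, C (c ^ (k - 1 - i)) * r i).degree < l.length := by
        refine (degree_sum_le _ _).trans_lt
          ((Finset.sup_lt_iff (WithBot.bot_lt_coe _)).2 fun i _ => ?_)
        exact (degree_C_mul_le _ _).trans_lt (hr i)
      refine (degree_add_le _ _).trans_lt (max_lt ?_ ?_)
      · generalize ∑ i ∈ Finset.range k, C (c ^ (k - 1 - i)) * r i = s at h1 ⊢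
        rcases eq_or_ne s 0 with rfl | hs
        · simp
        · rw [degree_mul, degree_X_sub_C, degree_eq_natDegree hs, List.length_cons]
          rw [degree_eq_natDegree hs] at h1
          norm_cast at *
          omega
      · refine degree_C_le.trans_lt ?_
        rw [List.length_cons]
        exact_mod_cast Nat.succ_pos _
    · intro x hx
      rw [eval_finsetSum, List.length_cons, ← sum_range_choose_right]
      push_cast
      rw [Finset.sum_mul]
      refine (Finset.abs_sum_le_sum_abs _ _).trans (Finset.sum_le_sum fun i hi => ?_)
      rw [eval_mul, eval_C, abs_mul, abs_pow]
      refine (mul_le_mul (pow_le_pow_left₀ (abs_nonneg c) hc _) (hq i x hx) (abs_nonneg _)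
        (by positivity)).trans_eq ?_
      -- For `i < l.length` the exponent `i - l.length` is truncated, but the binomial coefficient
      -- vanishes.
      rcases lt_or_ge i l.length with h | h
      · simp [Nat.choose_eq_zero_of_lt h]
      · rw [mul_left_comm, ← pow_add]
        congr 2
        have := Finset.mem_range.1 hi
        omega

/-- A point close enough to the endpoint of larger modulus works, that modulus being positive
because `a < b`. -/
lemma exists_mem_Ioo_half_le_abs {a b : ℝ} (hab : a < b) :
    ∃ ξ ∈ Ioo a b, max |a| |b| / 2 ≤ |ξ| := by
  rcases le_total |a| |b| with h | h
  · have hb : 0 < |b| := by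
      refine (abs_nonneg b).lt_of_ne fun h0 => ?_
      have ha : a = 0 := abs_eq_zero.1 (le_antisymm (h0 ▸ h) (abs_nonneg a))
      exact hab.ne (ha.trans (abs_eq_zero.1 h0.symm).symm)
    have hδ : 0 < min ((b - a) / 2) (|b| / 2) := lt_min (by linarith) (by linarith)
    have h1 := min_le_left ((b - a) / 2) (|b| / 2)
    have h2 := min_le_right ((b - a) / 2) (|b| / 2)
    refine ⟨b - min ((b - a) / 2) (|b| / 2), ⟨by linarith, by linarith⟩, ?_⟩
    have h3 := abs_sub_abs_le_abs_sub b (min ((b - a) / 2) (|b| / 2))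
    rw [abs_of_pos hδ] at h3
    rw [max_eq_right h]; linarith
  · have ha : 0 < |a| := by
      refine (abs_nonneg a).lt_of_ne fun h0 => ?_
      have hb : b = 0 := abs_eq_zero.1 (le_antisymm (h0 ▸ h) (abs_nonneg b))
      exact hab.ne ((abs_eq_zero.1 h0.symm).trans hb.symm)
    have hδ : 0 < min ((b - a) / 2) (|a| / 2) := lt_min (by linarith) (by linarith)
    have h1 := min_le_left ((b - a) / 2) (|a| / 2)
    have h2 := min_le_right ((b - a) / 2) (|a| / 2)
    refine ⟨a + min ((b - a) / 2) (|a| / 2), ⟨by linarith, by linarith⟩, ?_⟩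
    have h3 := abs_sub_abs_le_abs_sub a (-min ((b - a) / 2) (|a| / 2))
    rw [abs_neg, abs_of_pos hδ, sub_neg_eq_add] at h3
    rw [max_eq_left h]; linarith

lemma abs_le_max_abs_of_mem_Icc {a b x : ℝ} (hx : x ∈ Icc a b) : |x| ≤ max |a| |b| :=
  abs_le_max_abs_abs hx.1 hx.2

variable {a b : ℝ} {w : ℝ → ℝ} {p : ℕ → ℝ[X]}

/-- The error of the Gauss rule on a monomial. -/
lemma IsOrthogonalSystem.abs_quadrature_error_pow_le (hp : IsOrthogonalSystem a b w p)
    (hab : a < b) (hw_pos : ∀ x ∈ Ioo a b, 0 < w x) (hw : IntegrableOn w (Ioo a b)) (n k : ℕ) :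
    |(∫ x in Ioo a b, x ^ k * w x) - ∑ c ∈ nodes p n, weight a b w p n c * c ^ k| ≤
      k.choose (2 * n + 2) * max |a| |b| ^ (k - (2 * n + 2)) *
        ∫ x in Ioo a b, w x * nodePoly p n x ^ 2 := by
  set M := max |a| |b| with hM
  have hM0 : 0 ≤ M := (abs_nonneg a).trans (le_max_left _ _)
  -- Each node is listed twice, so the divisor is the square of the node polynomial.
  set l := (nodes p n).toList ++ (nodes p n).toList with hl
  have hlen : l.length = 2 * n + 2 := by
    rw [hl, List.length_append, Finset.length_toList, hp.card_nodes hab hw_pos hw n]; ring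
  have hprod : (l.map fun c => X - C c).prod = nodePolynomial p n * nodePolynomial p n := by
    rw [hl, List.map_append, List.prod_append, Finset.prod_map_toList]; rfl
  have hnode : ∀ c ∈ nodes p n, c ∈ Ioo a b := fun c hc =>
    hp.root_mem_Ioo hab hw_pos hw (isRoot_of_mem_roots (Multiset.mem_toFinset.1 hc))
  obtain ⟨q, r, hqr, hr, hq⟩ := exists_monomial_eq_prod_mul_add (M := M) l (fun c hc => by
    have hc' : c ∈ nodes p n := by simpa [hl] using hc
    exact abs_le_max_abs_of_mem_Icc (Ioo_subset_Icc_self (hnode c hc'))) k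
  rw [hprod] at hqr
  rw [hlen] at hr hq
  have heval : ∀ x : ℝ, x ^ k = nodePoly p n x ^ 2 * q.eval x + r.eval x := by
    intro x
    have h := congrArg (Polynomial.eval x) hqr
    rw [eval_pow, eval_X, eval_add, eval_mul, eval_mul, eval_nodePolynomial] at h
    rw [h, sq]
  have hsum : ∑ c ∈ nodes p n, weight a b w p n c * c ^ k = ∫ x in Ioo a b, r.eval x * w x := by
    rw [hp.quadrature_exact hab hw_pos hw hr]
    refine Finset.sum_congr rfl fun c hc => ?_
    have h0 : nodePoly p n c = 0 := Finset.prod_eq_zero hc (sub_self c)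
    rw [heval c, h0]; ring
  have hcont : Continuous (nodePoly p n) := by
    have h := (nodePolynomial p n).continuous
    exact h.congr fun x => eval_nodePolynomial n x
  have hi : IntegrableOn (fun x => w x * nodePoly p n x ^ 2) (Ioo a b) := by
    refine (integrableOn_continuous_mul hw (hcont.pow 2).continuousOn).congr_fun
      (fun x _ => mul_comm _ _) measurableSet_Ioo
  have hi' : IntegrableOn (fun x => nodePoly p n x ^ 2 * q.eval x * w x) (Ioo a b) :=
    integrableOn_continuous_mul hw ((hcont.pow 2).mul q.continuous).continuousOn
  have hdiff : (∫ x in Ioo a b, x ^ k * w x) - ∑ c ∈ nodes p n, weight a b w p n c * c ^ k =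
      ∫ x in Ioo a b, nodePoly p n x ^ 2 * q.eval x * w x := by
    rw [hsum, sub_eq_iff_eq_add, ← integral_add hi' (integrableOn_eval_mul hw r)]
    refine integral_congr_ae (Filter.Eventually.of_forall fun x => ?_)
    simp only [heval x, add_mul]
  rw [hdiff, ← integral_const_mul, ← Real.norm_eq_abs]
  refine norm_integral_le_of_norm_le (hi.const_mul _) ?_
  refine (ae_restrict_iff' measurableSet_Ioo).2 (Filter.Eventually.of_forall fun x hx => ?_)
  rw [Real.norm_eq_abs, abs_mul, abs_mul, abs_of_nonneg (sq_nonneg (nodePoly p n x)),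
    abs_of_pos (hw_pos x hx)]
  have h1 := hq x (abs_le_max_abs_of_mem_Icc (Ioo_subset_Icc_self hx))
  have h2 : 0 ≤ nodePoly p n x ^ 2 * w x := mul_nonneg (sq_nonneg _) (hw_pos x hx).le
  calc nodePoly p n x ^ 2 * |q.eval x| * w x = |q.eval x| * (nodePoly p n x ^ 2 * w x) := by ring
    _ ≤ _ := mul_le_mul_of_nonneg_right h1 h2
    _ = _ := by ring

/-! ### The quadrature error on a power series. -/

section PowerSeries

variable {A : ℕ → ℝ} {Λ : ℝ}

/-- Dropping one factorial leaves an exponential series that dominates uniformly on `|x| ≤ M`. -/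
lemma norm_pow_mul_coeff_le (hA : ∀ k, |A k| ≤ Λ ^ k / (k.factorial : ℝ) ^ 2) (hΛ : 0 ≤ Λ)
    {M x : ℝ} (hx : |x| ≤ M) (k : ℕ) : ‖x ^ k * A k‖ ≤ (M * Λ) ^ k / k.factorial := by
  have hM : 0 ≤ M := (abs_nonneg x).trans hx
  have hk : (1 : ℝ) ≤ k.factorial := by exact_mod_cast k.factorial_pos
  rw [norm_mul, norm_pow, Real.norm_eq_abs, Real.norm_eq_abs, mul_pow, mul_div_assoc]
  refine mul_le_mul (pow_le_pow_left₀ (abs_nonneg x) hx k) ((hA k).trans ?_) (abs_nonneg _)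
    (by positivity)
  exact div_le_div_of_nonneg_left (by positivity) (by positivity) (by nlinarith)

lemma summable_pow_mul_coeff (hA : ∀ k, |A k| ≤ Λ ^ k / (k.factorial : ℝ) ^ 2) (hΛ : 0 ≤ Λ)
    (x : ℝ) : Summable fun k => x ^ k * A k :=
  .of_norm_bounded (Real.summable_pow_div_factorial (|x| * Λ))
    (norm_pow_mul_coeff_le hA hΛ le_rfl)

lemma integrableOn_tsum_mul (hA : ∀ k, |A k| ≤ Λ ^ k / (k.factorial : ℝ) ^ 2) (hΛ : 0 ≤ Λ)
    (hw : IntegrableOn w (Ioo a b)) :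
    IntegrableOn (fun x => (∑' k, x ^ k * A k) * w x) (Ioo a b) := by
  have hc : ContinuousOn (fun x : ℝ => ∑' k, x ^ k * A k) (Icc a b) := by
    refine continuousOn_tsum (fun k => ((continuous_pow k).mul_const (A k)).continuousOn)
      (Real.summable_pow_div_factorial (max |a| |b| * Λ)) fun k x hx => ?_
    exact norm_pow_mul_coeff_le hA hΛ (abs_le_max_abs_of_mem_Icc hx) k
  exact integrableOn_continuous_mul hw hc

lemma hasSum_integral_pow_mul (hA : ∀ k, |A k| ≤ Λ ^ k / (k.factorial : ℝ) ^ 2) (hΛ : 0 ≤ Λ)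
    (hw : IntegrableOn w (Ioo a b)) :
    HasSum (fun k => A k * ∫ x in Ioo a b, x ^ k * w x)
      (∫ x in Ioo a b, (∑' k, x ^ k * A k) * w x) := by
  have hs := Real.summable_pow_div_factorial (max |a| |b| * Λ)
  have h := hasSum_integral_of_dominated_convergence (μ := volume.restrict (Ioo a b))
    (F := fun k x => A k * (x ^ k * w x)) (f := fun x => (∑' k, x ^ k * A k) * w x)
    (fun k x => (max |a| |b| * Λ) ^ k / k.factorial * ‖w x‖) (fun k => ?_) (fun k => ?_) ?_ ?_ ?_
  · simpa only [integral_const_mul] using h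
  · have hk : IntegrableOn (fun x => x ^ k * w x) (Ioo a b) :=
      integrableOn_continuous_mul hw (continuous_pow k).continuousOn
    exact hk.aestronglyMeasurable.const_mul (A k)
  · refine (ae_restrict_iff' measurableSet_Ioo).2 (Filter.Eventually.of_forall fun x hx => ?_)
    rw [← mul_assoc, mul_comm (A k), norm_mul]
    exact mul_le_mul_of_nonneg_right
      (norm_pow_mul_coeff_le hA hΛ (abs_le_max_abs_of_mem_Icc (Ioo_subset_Icc_self hx)) k)
      (norm_nonneg _)
  · exact Filter.Eventually.of_forall fun x => hs.mul_right _
  · simp_rw [tsum_mul_right]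
    exact hw.norm.const_mul _
  · refine Filter.Eventually.of_forall fun x => ?_
    have h := (summable_pow_mul_coeff hA hΛ x).hasSum.mul_right (w x)
    refine h.congr_fun ?_
    intro k; ring

/-- The error of the Gauss rule on an entire function with coefficients of size
`Λ ^ k / (k !) ^ 2`. -/
lemma IsOrthogonalSystem.abs_quadrature_error_le (hp : IsOrthogonalSystem a b w p)
    (hab : a < b) (hw_pos : ∀ x ∈ Ioo a b, 0 < w x) (hw : IntegrableOn w (Ioo a b))
    (hA : ∀ k, |A k| ≤ Λ ^ k / (k.factorial : ℝ) ^ 2) (hΛ : 0 ≤ Λ) (n : ℕ) :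
    |(∫ x in Ioo a b, (∑' k, x ^ k * A k) * w x) -
        ∑ c ∈ nodes p n, weight a b w p n c * ∑' k, c ^ k * A k| ≤
      Λ ^ (2 * n + 2) * Real.exp (max |a| |b| / 2 * Λ) / ((2 * n + 2).factorial : ℝ) ^ 2 *
        ∫ x in Ioo a b, w x * nodePoly p n x ^ 2 := by
  set M := max |a| |b| with hM
  have hM0 : 0 ≤ M := (abs_nonneg a).trans (le_max_left _ _)
  set m := 2 * n + 2 with hm
  set W := ∫ x in Ioo a b, w x * nodePoly p n x ^ 2 with hW
  have hW0 : 0 ≤ W := setIntegral_nonneg measurableSet_Ioo fun x hx =>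
    mul_nonneg (hw_pos x hx).le (sq_nonneg _)
  let err : ℕ → ℝ := fun k =>
    (∫ x in Ioo a b, x ^ k * w x) - ∑ c ∈ nodes p n, weight a b w p n c * c ^ k
  have herr : ∀ k, |err k| ≤ k.choose m * M ^ (k - m) * W := fun k =>
    hp.abs_quadrature_error_pow_le hab hw_pos hw n k
  have hsum : HasSum (fun k => A k * err k) ((∫ x in Ioo a b, (∑' k, x ^ k * A k) * w x) -
      ∑ c ∈ nodes p n, weight a b w p n c * ∑' k, c ^ k * A k) := by
    have h2 : HasSum (fun k => ∑ c ∈ nodes p n, weight a b w p n c * (c ^ k * A k))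
        (∑ c ∈ nodes p n, weight a b w p n c * ∑' k, c ^ k * A k) :=
      hasSum_sum fun c _ => (summable_pow_mul_coeff hA hΛ c).hasSum.mul_left _
    refine ((hasSum_integral_pow_mul hA hΛ hw).sub h2).congr_fun fun k => ?_
    simp only [err, mul_sub, Finset.mul_sum]
    congr 1
    exact Finset.sum_congr rfl fun c _ => by ring
  -- Exactness below degree `m`, read off from the vanishing binomial coefficient.
  have hzero : ∑ k ∈ Finset.range m, A k * err k = 0 := by
    refine Finset.sum_eq_zero fun k hk => ?_
    have h := herr k
    rw [Nat.choose_eq_zero_of_lt (Finset.mem_range.1 hk)] at h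
    have h0 : err k = 0 := by simpa using h
    rw [h0, mul_zero]
  have hshift := (hasSum_nat_add_iff' m).2 hsum
  have hexp : HasSum (fun j : ℕ => Λ ^ m / (m.factorial : ℝ) ^ 2 * W *
      ((M / 2 * Λ) ^ j / j.factorial))
      (Λ ^ m / (m.factorial : ℝ) ^ 2 * W * Real.exp (M / 2 * Λ)) := by
    rw [Real.exp_eq_exp_ℝ]
    exact (NormedSpace.expSeries_div_hasSum_exp (M / 2 * Λ)).mul_left _
  have hterm : ∀ j, ‖A (j + m) * err (j + m)‖ ≤ Λ ^ m / (m.factorial : ℝ) ^ 2 * W *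
      ((M / 2 * Λ) ^ j / j.factorial) := by
    clear_value m
    intro j
    rw [norm_mul, Real.norm_eq_abs, Real.norm_eq_abs]
    refine (mul_le_mul (hA _) (herr _) (abs_nonneg _) (by positivity)).trans ?_
    -- Each of the `j` factors beyond `m!` is at least `m + 1 ≥ 2`; this yields `M / 2` in the
    -- exponential.
    have hfac : (m.factorial : ℝ) * 2 ^ j ≤ ((j + m).factorial : ℝ) := by
      have h1 : m.factorial * 2 ^ j ≤ m.factorial * (m + 1) ^ j :=
        Nat.mul_le_mul_left _ (Nat.pow_le_pow_left (by omega) _)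
      have h2 := h1.trans (Nat.factorial_mul_pow_le_factorial (m := m) (n := j))
      rw [add_comm m j] at h2
      exact_mod_cast h2
    have hch : ((j + m).choose m : ℝ) = (j + m).factorial / (j.factorial * m.factorial) := by
      rw [Nat.add_choose, Nat.cast_div (Nat.factorial_mul_factorial_dvd_factorial_add j m)
        (by positivity)]
      push_cast; rfl
    rw [hch, Nat.add_sub_cancel]
    have hf1 : (0 : ℝ) < (j + m).factorial := by exact_mod_cast Nat.factorial_pos _
    have hf2 : (0 : ℝ) < m.factorial := by exact_mod_cast Nat.factorial_pos _
    have hf3 : (0 : ℝ) < j.factorial := by exact_mod_cast Nat.factorial_pos _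
    have e1 : Λ ^ (j + m) / ((j + m).factorial : ℝ) ^ 2 *
        ((j + m).factorial / (j.factorial * m.factorial) * M ^ j * W) =
        (Λ ^ (j + m) * M ^ j * W / (j.factorial * m.factorial)) / (j + m).factorial := by
      field_simp
    have e2 : Λ ^ m / (m.factorial : ℝ) ^ 2 * W * ((M / 2 * Λ) ^ j / j.factorial) =
        (Λ ^ (j + m) * M ^ j * W / (j.factorial * m.factorial)) / (m.factorial * 2 ^ j) := by
      rw [mul_pow, div_pow, pow_add]
      field_simp
    rw [e1, e2]
    exact div_le_div_of_nonneg_left (by positivity) (by positivity) hfac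
  rw [hzero, sub_zero] at hshift
  refine (hshift.norm_le_of_bounded hexp hterm).trans_eq ?_
  ring

end PowerSeries

end GaussQuadrature

end

theorem proposition4p2
    {V : Type*} [NormedAddCommGroup V] [InnerProductSpace ℝ V] [FiniteDimensional ℝ V]
    {ι : Type*} [Fintype ι] (e : OrthonormalBasis ι ℝ V)
    {α β : ℝ} (γ σ : BVPath α β V) (s t : Set.Icc α β)
    {a b : ℝ} (hab : a < b)
    (w : ℝ → ℝ) (hw_cont : ContinuousOn w (Set.Ioo a b))
    (hw_pos : ∀ x ∈ Set.Ioo a b, 0 < w x)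
    (hw_int : IntegrableOn w (Set.Ioo a b))
    (p : ℕ → Polynomial ℝ) (hp : GaussQuadrature.IsOrthogonalSystem a b w p) (n : ℕ) :
    -- the kernel series converges, the integral exists, and there are `n + 1` nodes
    (∀ x : ℝ, Summable (BVPath.sigInner e (γ.scale x) σ s t)) ∧
    IntegrableOn (fun x => BVPath.sigKernel e (γ.scale x) σ s t * w x) (Set.Ioo a b) ∧
    (GaussQuadrature.nodes p n).card = n + 1 ∧
    -- the error bound
    ∃ ξ ∈ Set.Ioo a b,
      |(∫ x in Set.Ioo a b, BVPath.sigKernel e (γ.scale x) σ s t * w x) -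
          ∑ c ∈ GaussQuadrature.nodes p n,
            GaussQuadrature.weight a b w p n c * BVPath.sigKernel e (γ.scale c) σ s t| ≤
        γ.length s ^ (2 * n + 2) * σ.length t ^ (2 * n + 2) *
            Real.exp (|ξ| * (γ.length s * σ.length t)) /
          ((2 * n + 2).factorial : ℝ) ^ 2 *
          ∫ x in Set.Ioo a b, w x * GaussQuadrature.nodePoly p n x ^ 2 := by
  have hA := BVPath.abs_sigInner_le e γ σ s t
  have hΛ : 0 ≤ γ.length s * σ.length t := mul_nonneg (γ.length_nonneg s) (σ.length_nonneg t)
  have hK : ∀ x, BVPath.sigKernel e (γ.scale x) σ s t =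
      ∑' k, x ^ k * BVPath.sigInner e γ σ s t k := fun x =>
    tsum_congr fun k => BVPath.sigInner_scale e x γ σ s t k
  simp_rw [hK]
  refine ⟨fun x => ?_, GaussQuadrature.integrableOn_tsum_mul hA hΛ hw_int,
    hp.card_nodes hab hw_pos hw_int n, ?_⟩
  · exact (GaussQuadrature.summable_pow_mul_coeff hA hΛ x).congr fun k =>
      (BVPath.sigInner_scale e x γ σ s t k).symm
  -- Any `ξ` with `max |a| |b| / 2 ≤ |ξ|` serves, by monotonicity of the exponential.
  obtain ⟨ξ, hξ, hle⟩ := GaussQuadrature.exists_mem_Ioo_half_le_abs hab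
  refine ⟨ξ, hξ, (hp.abs_quadrature_error_le hab hw_pos hw_int hA hΛ n).trans ?_⟩
  rw [mul_pow]
  refine mul_le_mul_of_nonneg_right ?_ (setIntegral_nonneg measurableSet_Ioo fun x hx =>
    mul_nonneg (hw_pos x hx).le (sq_nonneg _))
  have h1 := γ.length_nonneg s
  have h2 := σ.length_nonneg t
  gcongr
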